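/- Let $k\ge 4$ be an even integer, let $M\ge 1$ be squarefree, and let $X$ be a real number. Let $(\psi_1,\varphi_1),\dots,(\psi_\epsilon,\varphi_\epsilon)$ be all the pairs of primitive Dirichlet characters, of conductors $u$ and $v$, such that $d=uv$ divides $M$ and $\psi\varphi$ is the principal character modulo $d$; they index the Eisenstein newforms $E_k^{\psi,\varphi}$ of weight $k$ and level $d\mid M$, whose $n$-th Fourier coefficient is $\sum_{ab=n}\psi(a)\varphi(b)b^{k-1}$ for $n\ge 1$. Let $f_1,\dots,f_s$ be a basis of $\bigoplus_{d\mid M}\mathscr S_k^{new}(\Gamma_0(d))$ consisting of newforms (normalised Hecke eigenforms), and put $m=\epsilon+s$. For a prime $p$ write $\hat a_p(f)=a_p(f)/p^{(k-1)/2}$, a real number for each newform $f$. For an $m$-tuple $(p_\delta)$ of primes let $E$ be the $m\times\epsilon$ matrix with entries $E_{ij}=\psi_j(p_i)p_i^{(1-k)/2}+\varphi_j(p_i)p_i^{(k-1)/2}$, let $S$ be the $m\times s$ matrix with entries $S_{ij}=\tfrac12\hat a_{p_i}(f_j)$, and let $(E\mid S)(p_\delta)$ be the $m\times m$ matrix formed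 by $E$ and $S$ side by side. A primed sum omits the primes dividing $M$. Put $$\pi_{M,\ell}(X)=\sum_{p\le X}{}^{'}\,p^{\ell},\qquad \pi_M(X)=\pi_{M,0}(X),\qquad E(X)=\pi_{M,1-k}(X)+2\pi_M(X),$$ $$F(X)=\max_{\chi}\Bigl|\sum_{p\le X}{}^{'}\chi(p)p^{(k-1)/2}\Bigr|,$$ the maximum over the Dirichlet characters $\chi$ modulo $M$ of conductor greater than $1$, $$G(X)=\max_{\chi,\,j}\Bigl|\sum_{p\le X}{}^{'}\hat a_p(f_j)\chi(p)p^{(k-1)/2}\Bigr|,$$ the maximum over all Dirichlet characters $\chi$ modulo $M$ and all $1\le j\le s$, and $$H(X)=\max\Bigl(\Bigl\{\Bigl|\sum_{p\le X}{}^{'}U_2\bigl(\tfrac12\hat a_p(f_j)\bigr)\Bigr| : j\Bigr\}\cup\Bigl\{\Bigl|\sum_{p\le X}{}^{'}\hat a_p(f_i)\hat a_p(f_j)\Bigr| : i\ne j\Bigr\}\Bigr),\qquad U_2(T)=4T^2-1.$$ A maximum over an empty set is $0$. Finally put $$Q(X)=(H(X)+\pi_M(X))^s-\pi_M(X)^s+s\log(s+3)\,(H(X)+\pi_M(X))^{s-1}H(X).$$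 (When $s=0$ or $\epsilon=0$, a term with the factor $s$ or $\epsilon$ is $0$.) Suppose that $$E(X)+\pi_{M,k-1}(X)\ge 12\,\epsilon\,(E(X)+F(X)),$$ $$H(X)+\pi_M(X)\ge 12\,s\,H(X),$$ $$(E(X)+\pi_{M,k-1}(X))(H(X)+\pi_M(X))\ge 6\,\epsilon s\,(\pi_{M,(1-k)/2}(X)+G(X))^2.$$ Then $$\begin{aligned} &\Bigl|\,4^s(m!)^{-1}\sum_{(p_\delta)\le X}{}^{'}\bigl|\det(E\mid S)(p_\delta)\bigr|^2-\pi_M(X)^s\pi_{M,k-1}(X)^{\epsilon}\Bigr|\ \le\ \pi_{M,k-1}(X)^{\epsilon}\,Q(X)\\ &\quad+\epsilon\log(\epsilon+3)\,(E(X)+\pi_{M,k-1}(X))^{\epsilon-1}(E(X)+F(X))\,Q(X)\\ &\quad+\epsilon\log(\epsilon+3)\,\pi_M(X)^s(E(X)+\pi_{M,k-1}(X))^{\epsilon-1}(E(X)+F(X))\\ &\quad+\epsilon\log(\epsilon+3)\,s\log(s+3)\,(E(X)+\pi_{M,k-1}(X))^{\epsilon-1}(H(X)+\pi_M(X))^{s-1}(\pi_{M,(1-k)/2}(X)+G(X))^2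 . \end{aligned}$$ -/

import Mathlib

open scoped MatrixGroups

noncomputable section

namespace EisCusp

/-! ### Cusp forms on `Γ₀(N)`, oldforms, newforms -/

/-- `f : ℍ → ℂ` is a cusp form of weight `k` on `Γ₀(N)`. -/
def IsCuspFormOn (k N : ℕ) (f : UpperHalfPlane → ℂ) : Prop :=
  ∃ F : CuspForm ((CongruenceSubgroup.Gamma0 N).map
    (Matrix.SpecialLinearGroup.mapGL ℝ : SL(2, ℤ) →* GL (Fin 2) ℝ)) (k : ℤ), ⇑F = f

/-- The `n`-th Fourier coefficient `a_n(f)`, where `f(z) = ∑ a_n(f) e^{2πinz}`. -/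
def fourierCoeff (f : UpperHalfPlane → ℂ) (n : ℕ) : ℂ :=
  PowerSeries.coeff n (UpperHalfPlane.qExpansion 1 f)

/-- The Petersson scalar product for `Γ₀(N)` (unnormalised): the integral over `Γ₀(N) \ ℍ` with
respect to `dx dy / y²`, written as the integral over the standard fundamental domain of `SL₂(ℤ)`
of the sum over coset representatives. The sum is finite, and each term does not depend on the
chosen representative. -/
def peterssonInner (k N : ℕ) (f g : UpperHalfPlane → ℂ) : ℂ :=
  ∫ z in ModularGroup.fd, ∑ᶠ c : SL(2, ℤ) ⧸ CongruenceSubgroup.Gamma0 N,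
    UpperHalfPlane.petersson (k : ℤ) f g ((Quotient.out c : SL(2, ℤ))⁻¹ • z)

/-- The subspace of oldforms in `S_k(Γ₀(N))`: spanned by all `z ↦ g(ez)` with `g ∈ S_k(Γ₀(d))`,
`de ∣ N` and `d ≠ N`. -/
def oldSpace (k N : ℕ) : Submodule ℂ (UpperHalfPlane → ℂ) :=
  Submodule.span ℂ {h | ∃ (d e : ℕ) (g : UpperHalfPlane → ℂ), d * e ∣ N ∧ d ≠ N ∧ IsCuspFormOn k d g ∧
    h = fun z : UpperHalfPlane => g (UpperHalfPlane.ofComplex ((e : ℂ) * (z : ℂ)))}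

/-- `f` lies in `S_k^new(Γ₀(N))`, the orthogonal complement of the oldforms. -/
def IsNewCusp (k N : ℕ) (f : UpperHalfPlane → ℂ) : Prop :=
  IsCuspFormOn k N f ∧ ∀ g ∈ oldSpace k N, peterssonInner k N g f = 0

/-- The Hecke operator `T_p` on weight `k`, level `Γ₀(N)`, for a prime `p` (often written `U_p` if
`p ∣ N`): `(T_p f)(z) = 1_{p ∤ N} p^{k-1} f(pz) + p⁻¹ ∑_{j mod p} f((z + j) / p)`. -/
def heckeT (k N p : ℕ) (f : UpperHalfPlane → ℂ) : UpperHalfPlane → ℂ := fun z =>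
  (if p ∣ N then 0 else (p : ℂ) ^ (k - 1) * f (UpperHalfPlane.ofComplex ((p : ℂ) * (z : ℂ)))) +
    (p : ℂ)⁻¹ * ∑ j ∈ Finset.range p, f (UpperHalfPlane.ofComplex (((z : ℂ) + (j : ℂ)) / (p : ℂ)))

/-- A (cuspidal) newform of weight `k` and level `N`, with trivial nebentypus: an element of the new
subspace that is an eigenvector of all Hecke operators, normalised by `a_1(f) = 1`. -/
def IsNewform (k N : ℕ) (f : UpperHalfPlane → ℂ) : Prop :=
  IsNewCusp k N f ∧ fourierCoeff f 1 = 1 ∧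
    ∀ p : ℕ, p.Prime → ∃ c : ℂ, heckeT k N p f = c • f

/-- `f_1, …, f_s` is a basis of `⨁_{d ∣ M} S_k^new(Γ₀(d))` (an internal direct sum of spaces of
functions on `ℍ`) that consists of newforms. -/
structure IsNewformBasis (k M : ℕ) {s : ℕ} (f : Fin s → UpperHalfPlane → ℂ) : Prop where
  isNewform : ∀ j, ∃ d, d ∣ M ∧ IsNewform k d (f j)
  linearIndependent : LinearIndependent ℂ f
  span_eq : Submodule.span ℂ (Set.range f) = Submodule.span ℂ {g | ∃ d, d ∣ M ∧ IsNewCusp k d g}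

/-- The normalised coefficient `â_p(f) = a_p(f) / p^{(k-1)/2}` of a newform `f` of weight `k`. The
Fourier coefficients of a newform on `Γ₀(N)` are real, so `re` only moves them from `ℂ` to `ℝ`. -/
def normCoeff (k : ℕ) (f : UpperHalfPlane → ℂ) (p : ℕ) : ℝ :=
  (fourierCoeff f p).re / (p : ℝ) ^ (((k : ℝ) - 1) / 2)

/-! ### Eisenstein newforms -/

/-- A pair `(ψ, φ)` of primitive Dirichlet characters, of conductors `u` and `v`, with `uv ∣ M`
and `ψφ` the principal character modulo `d = uv`. These pairs index the Eisenstein newforms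
`E_k^{ψ,φ}` of level `d` dividing `M` (for even `k ≥ 4`). -/
structure EisensteinPair (M : ℕ) where
  u : ℕ
  v : ℕ
  ψ : DirichletCharacter ℂ u
  φ : DirichletCharacter ℂ v
  ψ_primitive : ψ.IsPrimitive
  φ_primitive : φ.IsPrimitive
  dvd : u * v ∣ M
  mul_eq_one : DirichletCharacter.changeLevel (Dvd.intro v rfl) ψ *
    DirichletCharacter.changeLevel (Dvd.intro_left u rfl) φ = (1 : DirichletCharacter ℂ (u * v))

/-- The `n`-th Fourier coefficient (`n ≥ 1`) of `E_k^{ψ,φ}`, which is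
`σ_{k-1}^{ψ,φ}(n) = ∑_{ab = n} ψ(a) φ(b) b^{k-1}`. -/
def EisensteinPair.coeff {M : ℕ} (P : EisensteinPair M) (k n : ℕ) : ℂ :=
  ∑ ab ∈ n.divisorsAntidiagonal, P.ψ (ab.1 : ZMod P.u) * P.φ (ab.2 : ZMod P.v) *
    (ab.2 : ℂ) ^ (k - 1)

/-! ### The determinant -/

/-- The matrix `(E ∣ S)(p_δ)`. Its rows are indexed by the entries of the tuple `p_δ`, its columns
by the Eisenstein newforms (entries: normalised coefficients `a_p / p^{(k-1)/2}`) followed by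
the cuspidal newforms (entries: `â_p(f) / 2 = cos θ_p(f)`). -/
def matrixES (k M : ℕ) {ε s : ℕ} (P : Fin ε → EisensteinPair M)
    (f : Fin s → UpperHalfPlane → ℂ) (p : Fin ε ⊕ Fin s → ℕ) :
    Matrix (Fin ε ⊕ Fin s) (Fin ε ⊕ Fin s) ℂ :=
  Matrix.of fun i c => match c with
    | Sum.inl j => (P j).coeff k (p i) / (((p i : ℝ) ^ (((k : ℝ) - 1) / 2) : ℝ) : ℂ)
    | Sum.inr j => ((normCoeff k (f j) (p i) / 2 : ℝ) : ℂ)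

/-- The primes `p ≤ X` that do not divide `M`. -/
def primesUpTo (M : ℕ) (X : ℝ) : Finset ℕ :=
  {p ∈ Finset.range (⌊X⌋₊ + 1) | p.Prime ∧ ¬ p ∣ M}

/-- `∑' |det (E ∣ S)(p_δ)|²`, over all tuples of primes `p ≤ X` not dividing `M`. -/
def detSum (k M : ℕ) {ε s : ℕ} (P : Fin ε → EisensteinPair M)
    (f : Fin s → UpperHalfPlane → ℂ) (X : ℝ) : ℝ :=
  ∑ p ∈ Fintype.piFinset (fun _ : Fin ε ⊕ Fin s => primesUpTo M X), ‖(matrixES k M P f p).det‖ ^ 2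

/-! ### The quantities in the error term

Suprema over an empty index set are `0`; all other index sets are finite, so that the suprema are
maxima. -/

/-- `π_{M,ℓ}(X) = ∑' p^ℓ`. -/
def piSum (M : ℕ) (l X : ℝ) : ℝ := ∑ p ∈ primesUpTo M X, (p : ℝ) ^ l

/-- `E(X) = π_{M,1-k}(X) + 2 π_M(X)`. -/
def sumE (k M : ℕ) (X : ℝ) : ℝ := piSum M (1 - (k : ℝ)) X + 2 * piSum M 0 X

/-- `F(X)`: the maximum of `|∑' χ(p) p^{(k-1)/2}|` over `χ` mod `M` of conductor `> 1`. -/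
def sumF (k M : ℕ) (X : ℝ) : ℝ :=
  ⨆ χ : {χ : DirichletCharacter ℂ M // 1 < χ.conductor},
    ‖∑ p ∈ primesUpTo M X, χ.1 (p : ZMod M) * (((p : ℝ) ^ (((k : ℝ) - 1) / 2) : ℝ) : ℂ)‖

/-- `G(X)`: the maximum of `|∑' â_p(f) χ(p) p^{(k-1)/2}|` over `χ` mod `M` and `f` in the basis. -/
def sumG (k M : ℕ) {s : ℕ} (f : Fin s → UpperHalfPlane → ℂ) (X : ℝ) : ℝ :=
  ⨆ a : DirichletCharacter ℂ M × Fin s,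
    ‖∑ p ∈ primesUpTo M X, (normCoeff k (f a.2) p : ℂ) * a.1 (p : ZMod M) *
      (((p : ℝ) ^ (((k : ℝ) - 1) / 2) : ℝ) : ℂ)‖

/-- `U_2(T) = 4T² - 1`, the Chebyshev polynomial of the second kind of degree two. -/
def chebyshevU2 (T : ℝ) : ℝ := 4 * T ^ 2 - 1

/-- `H(X)`: the maximum of all `|∑' U_2(â_p(f) / 2)|`, for `f` in the basis, and all
`|∑' â_p(f) â_p(g)|`, for `f ≠ g` in the basis. -/
def sumH (k M : ℕ) {s : ℕ} (f : Fin s → UpperHalfPlane → ℂ) (X : ℝ) : ℝ :=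
  max (⨆ i : Fin s, |∑ p ∈ primesUpTo M X, chebyshevU2 (normCoeff k (f i) p / 2)|)
    (⨆ a : {a : Fin s × Fin s // a.1 ≠ a.2},
      |∑ p ∈ primesUpTo M X, normCoeff k (f a.1.1) p * normCoeff k (f a.1.2) p|)

/-- `Q(X) = (H + π_M)^s - π_M^s + s log(s+3) (H + π_M)^{s-1} H`; for `s = 0` the last term
is `0`. -/
def sumQ (k M : ℕ) {s : ℕ} (f : Fin s → UpperHalfPlane → ℂ) (X : ℝ) : ℝ :=
  (sumH k M f X + piSum M 0 X) ^ s - piSum M 0 X ^ s +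
    s * Real.log (s + 3) * (sumH k M f X + piSum M 0 X) ^ (s - 1) * sumH k M f X

end EisCusp

end

open EisCusp

/-! Squarefreeness forces ε = 1: ψφ principal makes the conductors u and v equal, while uv
squarefree makes them coprime, so u = v = 1. The single Eisenstein column is then p^{(1-k)/2} +
p^{(k-1)/2}. By Andréief's identity the sum of squared determinants is m! times a Gram determinant.
Its cuspidal block C lies entrywise within H of T·1, where T = π_M(X). With V = π_{M,1-k}(X) and W =
π_{M,k-1}(X), the Eisenstein corner is V + 2T + W, and b is the border. The Schur complement gives
det C · (V + 2T + W - q) with q = bᵀC⁻¹b. Three estimates remain: det C is T^s up to a relative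
error of order sH/T (`det_le_of_entry_near`, `le_det_of_entry_near`, through the trace and Frobenius
norm of C - T·1); q is nonnegative and small (`gram_schur_term_le`); and the logarithms in the
stated bound are large enough to absorb all constants (`abs_bordered_det_sub_le`). -/

/-! ### Andréief's identity -/

namespace Matrix

/-- **Andréief's identity** (discrete form): summing the squared determinant of `(e_j (p_i))` over
all tuples `p` gives `n!` times the Gram determinant of the functions `e_j`. -/
theorem sum_piFinset_det_sq {ι α R : Type*} [Fintype ι] [DecidableEq ι] [CommRing R]
    (e : ι → α → R) (t : Finset α) :
    ∑ p ∈ Fintype.piFinset (fun _ : ι => t), (of fun i j => e j (p i)).det ^ 2 =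
      (Fintype.card ι).factorial * (of fun i j => ∑ x ∈ t, e i x * e j x).det := by
  -- Substituting p ∘ σ for p multiplies the determinant by sign σ, which cancels the sign in the
  -- Leibniz term; all m! terms become equal.
  have hswap : ∀ σ : Equiv.Perm ι,
      ∑ p ∈ Fintype.piFinset (fun _ : ι => t),
        (of fun i j => e j (p i)).det * ((Equiv.Perm.sign σ : ℤ) * ∏ i, e i (p (σ i))) =
      ∑ p ∈ Fintype.piFinset (fun _ : ι => t), (of fun i j => e j (p i)).det * ∏ i, e i (p i) := by
    intro σ
    refine Finset.sum_bij' (fun p _ => p ∘ σ) (fun p _ => p ∘ σ.symm) ?_ ?_ ?_ ?_ ?_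
    · intro p hp
      simp only [Fintype.mem_piFinset] at hp ⊢
      exact fun i => hp _
    · intro p hp
      simp only [Fintype.mem_piFinset] at hp ⊢
      exact fun i => hp _
    · intro p _
      ext i
      simp
    · intro p _
      ext i
      simp
    · intro p _
      have h := det_permute σ (of fun i j => e j (p i))
      have h' : (of fun i j => e j (p i)).submatrix σ id = of fun i j => e j ((p ∘ σ) i) := rfl
      rw [h'] at h
      rw [h, Function.comp_def]
      ring
  -- Once e_i(p_i) is absorbed into row i, that row depends on p_i alone, so multilinearity moves
  -- the sum over tuples into the rows.
  have hrow : ∀ p : ι → α, (of fun i j => e j (p i)).det * ∏ i, e i (p i) =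
      detRowAlternating (R := R) (fun i j => e i (p i) * e j (p i)) := by
    intro p
    rw [mul_comm]
    exact (det_mul_column (fun i => e i (p i)) (of fun i j => e j (p i))).symm
  calc ∑ p ∈ Fintype.piFinset (fun _ : ι => t), (of fun i j => e j (p i)).det ^ 2
      = ∑ p ∈ Fintype.piFinset (fun _ : ι => t), ∑ σ : Equiv.Perm ι,
        (of fun i j => e j (p i)).det * ((Equiv.Perm.sign σ : ℤ) * ∏ i, e i (p (σ i))) := by
        refine Finset.sum_congr rfl fun p _ => ?_
        rw [← Finset.mul_sum, sq]
        congr 1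
        rw [det_apply']
        rfl
    _ = ∑ σ : Equiv.Perm ι, ∑ p ∈ Fintype.piFinset (fun _ : ι => t),
          (of fun i j => e j (p i)).det * ∏ i, e i (p i) := by
        rw [Finset.sum_comm]
        exact Finset.sum_congr rfl fun σ _ => hswap σ
    _ = _ := by
        rw [Finset.sum_const, Finset.card_univ, Fintype.card_perm, nsmul_eq_mul]
        congr 1
        simp_rw [hrow]
        have h := (detRowAlternating (R := R) (n := ι)).toMultilinearMap.map_sum_finset
          (fun i x => fun j => e i x * e j x) (fun _ => t)
        refine h.symm.trans ?_
        change det _ = det _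
        congr 1
        ext i j
        simp

/-! ### Symmetric matrices close to a scalar matrix -/

theorem IsHermitian.trace_sq_eq_sum_eigenvalues {n : Type*} [Fintype n] [DecidableEq n]
    {C : Matrix n n ℝ} (hC : C.IsHermitian) :
    (C * C).trace = ∑ i, hC.eigenvalues i ^ 2 := by
  have h := hC.spectral_theorem
  rw [Unitary.conjStarAlgAut_apply] at h
  set U := hC.eigenvectorUnitary
  set D : Matrix n n ℝ := diagonal (RCLike.ofReal ∘ hC.eigenvalues) with hD
  have hU : star (U : Matrix n n ℝ) * (U : Matrix n n ℝ) = 1 := Unitary.coe_star_mul_self U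
  calc (C * C).trace
      = ((U : Matrix n n ℝ) * D * (star (U : Matrix n n ℝ) * U) * D * star (U : Matrix n n ℝ)).trace
        := by
        conv_lhs => rw [h]
        simp only [Matrix.mul_assoc]
    _ = (star (U : Matrix n n ℝ) * U * (D * D)).trace := by
        rw [hU, Matrix.mul_one, trace_mul_comm, Matrix.one_mul, ← Matrix.mul_assoc,
          ← Matrix.mul_assoc, hU, Matrix.one_mul]
    _ = _ := by
        rw [hU, Matrix.one_mul, hD, diagonal_mul_diagonal, trace_diagonal]
        simp [sq]

variable {n : Type*} [Fintype n] [DecidableEq n] {C : Matrix n n ℝ} {a h : ℝ}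

/-- A matrix entrywise within `h` of `a • 1` has quadratic form at least `a - n h`. -/
theorem le_quadForm_of_entry_near (hCa : ∀ i j, |C i j - a * (1 : Matrix n n ℝ) i j| ≤ h)
    (x : n → ℝ) : (a - Fintype.card n * h) * ∑ i, x i ^ 2 ≤ x ⬝ᵥ C *ᵥ x := by
  have h1 : x ⬝ᵥ C *ᵥ x = a * ∑ i, x i ^ 2 +
      ∑ i, ∑ j, x i * x j * (C i j - a * (1 : Matrix n n ℝ) i j) := by
    have h2 : ∀ i, ∑ j, x i * x j * (C i j - a * (1 : Matrix n n ℝ) i j) =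
        x i * (∑ j, C i j * x j) - a * x i ^ 2 := by
      intro i
      rw [Finset.mul_sum]
      have : a * x i ^ 2 = ∑ j, x i * x j * (a * (1 : Matrix n n ℝ) i j) := by
        simp [Matrix.one_apply]
        ring
      rw [this, ← Finset.sum_sub_distrib]
      exact Finset.sum_congr rfl fun j _ => by ring
    simp_rw [h2]
    rw [Finset.sum_sub_distrib, ← Finset.mul_sum]
    simp [dotProduct, mulVec]
  have h3 : -(h * (∑ i, |x i|) ^ 2) ≤
      ∑ i, ∑ j, x i * x j * (C i j - a * (1 : Matrix n n ℝ) i j) := by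
    rw [sq, Finset.sum_mul_sum, Finset.mul_sum, ← Finset.sum_neg_distrib]
    refine Finset.sum_le_sum fun i _ => ?_
    rw [Finset.mul_sum, ← Finset.sum_neg_distrib]
    refine Finset.sum_le_sum fun j _ => ?_
    refine (neg_le_neg ?_).trans (neg_abs_le _)
    rw [abs_mul, abs_mul, mul_comm h]
    exact mul_le_mul_of_nonneg_left (hCa i j) (by positivity)
  have h4 : (∑ i, |x i|) ^ 2 ≤ Fintype.card n * ∑ i, x i ^ 2 := by
    simpa using sq_sum_le_card_mul_sum_sq (s := Finset.univ) (f := fun i => |x i|)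
  -- Only an actual entry forces h ≥ 0, hence the case split.
  rcases isEmpty_or_nonempty n with hn | ⟨⟨i⟩⟩
  · simp
  · have hh : 0 ≤ h := (abs_nonneg _).trans (hCa i i)
    nlinarith [mul_le_mul_of_nonneg_left h4 hh]

theorem IsHermitian.le_eigenvalues_of_entry_near (hC : C.IsHermitian)
    (hCa : ∀ i j, |C i j - a * (1 : Matrix n n ℝ) i j| ≤ h) (i : n) :
    a - Fintype.card n * h ≤ hC.eigenvalues i := by
  have h1 := le_quadForm_of_entry_near hCa (hC.eigenvectorBasis i).ofLp
  rw [hC.mulVec_eigenvectorBasis, dotProduct_smul] at h1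
  have h2 : ∑ j, (hC.eigenvectorBasis i).ofLp j ^ 2 = 1 := by
    have h3 := EuclideanSpace.norm_sq_eq (hC.eigenvectorBasis i)
    rw [hC.eigenvectorBasis.norm_eq_one] at h3
    simpa using h3.symm
  have h3 : (hC.eigenvectorBasis i).ofLp ⬝ᵥ (hC.eigenvectorBasis i).ofLp = 1 := by
    rw [← h2]
    simp [dotProduct, sq]
  rw [h2, h3] at h1
  simpa using h1

/-- An AM-GM bound: multiply λ ≤ (a+h) exp(λ/(a+h) - 1) over the eigenvalues; the trace is at most
n(a+h), so the total exponent is at most 0. The condition n h ≤ a keeps the eigenvalues nonnegative.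
-/
theorem IsHermitian.det_le_of_entry_near (hC : C.IsHermitian) (ha : 0 < a) (hh : 0 ≤ h)
    (hah : Fintype.card n * h ≤ a)
    (hCa : ∀ i j, |C i j - a * (1 : Matrix n n ℝ) i j| ≤ h) :
    C.det ≤ (a + h) ^ Fintype.card n := by
  have hb : 0 < a + h := by linarith
  have htr : ∑ i, hC.eigenvalues i ≤ Fintype.card n * (a + h) := by
    have h1 := hC.trace_eq_sum_eigenvalues
    simp only [RCLike.ofReal_real_eq_id, id] at h1
    rw [← h1, trace, ← nsmul_eq_mul]
    refine Finset.sum_le_card_nsmul _ _ _ fun i _ => ?_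
    have := (abs_le.1 (hCa i i)).2
    simp only [one_apply_eq, mul_one] at this
    simp only [diag_apply]
    linarith
  have hdet : C.det = ∏ i, hC.eigenvalues i := by simpa using hC.det_eq_prod_eigenvalues
  have hnn : ∀ i, 0 ≤ hC.eigenvalues i := fun i => by
    have := hC.le_eigenvalues_of_entry_near hCa i
    linarith
  calc C.det ≤ ∏ i, ((a + h) * Real.exp (hC.eigenvalues i / (a + h) - 1)) := by
        rw [hdet]
        refine Finset.prod_le_prod (fun i _ => hnn i) fun i _ => ?_
        have h1 := Real.add_one_le_exp (hC.eigenvalues i / (a + h) - 1)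
        have h2 := mul_le_mul_of_nonneg_left h1 hb.le
        have h3 : (a + h) * (hC.eigenvalues i / (a + h) - 1 + 1) = hC.eigenvalues i := by
          field_simp
          ring
        linarith
    _ = (a + h) ^ Fintype.card n *
          Real.exp ((∑ i, hC.eigenvalues i) / (a + h) - Fintype.card n) := by
        rw [Finset.prod_mul_distrib, ← Real.exp_sum, Finset.sum_sub_distrib, Finset.sum_div]
        simp
    _ ≤ (a + h) ^ Fintype.card n * 1 := by
        refine mul_le_mul_of_nonneg_left ?_ (by positivity)
        rw [Real.exp_le_one_iff, sub_nonpos, div_le_iff₀ hb]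
        exact htr
    _ = _ := mul_one _

/-- Put t = (λ - a)/a for each eigenvalue λ. Since λ ≥ 10a/11, log(λ/a) ≥ 1 - a/λ ≥ t - (11/10)t².
With r = n h/a, the trace gives ∑ t ≥ -r and the Frobenius norm of C - a·1 gives ∑ t² ≤ r². Bounding
each eigenvalue separately would lose a further factor n. -/
theorem IsHermitian.le_det_of_entry_near (hC : C.IsHermitian) (ha : 0 < a) (hh : 0 ≤ h)
    (hah : 11 * (Fintype.card n * h) ≤ a)
    (hCa : ∀ i j, |C i j - a * (1 : Matrix n n ℝ) i j| ≤ h) :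
    a ^ Fintype.card n * (1 - 11 / 10 * (Fintype.card n * h) / a) ≤ C.det := by
  have hdet : C.det = ∏ i, hC.eigenvalues i := by simpa using hC.det_eq_prod_eigenvalues
  have hlow : ∀ i, 10 / 11 * a ≤ hC.eigenvalues i := fun i => by
    have := hC.le_eigenvalues_of_entry_near hCa i
    linarith
  have htr : -(Fintype.card n * h) ≤ ∑ i, (hC.eigenvalues i - a) := by
    have h1 := hC.trace_eq_sum_eigenvalues
    simp only [RCLike.ofReal_real_eq_id, id] at h1
    rw [Finset.sum_sub_distrib, ← h1, trace, ← Finset.sum_sub_distrib]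
    calc -(Fintype.card n * h) = ∑ _i : n, -h := by simp
      _ ≤ _ := Finset.sum_le_sum fun i _ => by
        have := (abs_le.1 (hCa i i)).1
        simp only [one_apply_eq, mul_one] at this
        simpa using this
  have hsq : ∑ i, (hC.eigenvalues i - a) ^ 2 ≤ (Fintype.card n * h) ^ 2 := by
    have h1 := hC.trace_eq_sum_eigenvalues
    simp only [RCLike.ofReal_real_eq_id, id] at h1
    have h2 : ∑ i, (hC.eigenvalues i - a) ^ 2 =
        ((C - a • (1 : Matrix n n ℝ)) * (C - a • (1 : Matrix n n ℝ))).trace := by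
      have h3 : (C - a • (1 : Matrix n n ℝ)) * (C - a • (1 : Matrix n n ℝ)) =
          C * C - (2 * a) • C + (a ^ 2) • (1 : Matrix n n ℝ) := by
        simp only [Matrix.sub_mul, Matrix.mul_sub, smul_mul_assoc, mul_smul_comm, Matrix.one_mul,
          Matrix.mul_one]
        module
      rw [h3, trace_add, trace_sub, trace_smul, trace_smul, hC.trace_sq_eq_sum_eigenvalues, h1,
        trace_one]
      simp only [sub_sq, Finset.sum_add_distrib, Finset.sum_sub_distrib, smul_eq_mul,
        Finset.mul_sum, Finset.sum_const, Finset.card_univ, nsmul_eq_mul]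
      have h4 : ∑ i, 2 * hC.eigenvalues i * a = ∑ i, 2 * a * hC.eigenvalues i :=
        Finset.sum_congr rfl fun i _ => by ring
      rw [h4]
      ring
    rw [h2, trace]
    have h4 : ∀ i j, (C - a • (1 : Matrix n n ℝ)) i j * (C - a • (1 : Matrix n n ℝ)) j i ≤ h ^ 2 := by
      intro i j
      refine (le_abs_self _).trans ?_
      rw [abs_mul, sq]
      exact mul_le_mul (by simpa using hCa i j) (by simpa using hCa j i) (abs_nonneg _) hh
    calc ∑ i, diag ((C - a • (1 : Matrix n n ℝ)) * (C - a • (1 : Matrix n n ℝ))) i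
        ≤ ∑ _i : n, ∑ _j : n, h ^ 2 := Finset.sum_le_sum fun i _ => by
          rw [diag_apply, mul_apply]
          exact Finset.sum_le_sum fun j _ => h4 i j
      _ = _ := by
          simp only [Finset.sum_const, Finset.card_univ, nsmul_eq_mul]
          ring
  set c : ℝ := Fintype.card n * h with hc
  have hc0 : 0 ≤ c := by positivity
  have hterm : ∀ i, a * Real.exp ((hC.eigenvalues i - a) / a -
      11 / 10 * ((hC.eigenvalues i - a) ^ 2 / a ^ 2)) ≤ hC.eigenvalues i := by
    intro i
    have hpos : 0 < hC.eigenvalues i := by linarith [hlow i]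
    have hlog := Real.one_sub_inv_le_log_of_pos (div_pos hpos ha)
    have hexp := Real.exp_log (div_pos hpos ha)
    have hle : (hC.eigenvalues i - a) / a - 11 / 10 * ((hC.eigenvalues i - a) ^ 2 / a ^ 2) ≤
        1 - (hC.eigenvalues i / a)⁻¹ := by
      have key : 1 - (hC.eigenvalues i / a)⁻¹ - ((hC.eigenvalues i - a) / a -
          11 / 10 * ((hC.eigenvalues i - a) ^ 2 / a ^ 2)) =
          (hC.eigenvalues i - a) ^ 2 / a ^ 2 * (11 / 10 - a / hC.eigenvalues i) := by
        field_simp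
        ring
      have h5 : a / hC.eigenvalues i ≤ 11 / 10 := by
        rw [div_le_iff₀ hpos]
        linarith [hlow i]
      have := mul_nonneg (show 0 ≤ (hC.eigenvalues i - a) ^ 2 / a ^ 2 by positivity)
        (sub_nonneg.2 h5)
      linarith
    have h6 := Real.exp_le_exp.2 (hle.trans hlog)
    rw [hexp, le_div_iff₀ ha] at h6
    linarith
  calc a ^ Fintype.card n * (1 - 11 / 10 * c / a)
      ≤ a ^ Fintype.card n * Real.exp (∑ i, ((hC.eigenvalues i - a) / a -
      11 / 10 * ((hC.eigenvalues i - a) ^ 2 / a ^ 2))) := by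
        refine mul_le_mul_of_nonneg_left ?_ (by positivity)
        refine le_trans ?_ (Real.add_one_le_exp _)
        rw [Finset.sum_sub_distrib, ← Finset.mul_sum, ← Finset.sum_div, ← Finset.sum_div]
        have h7 : -(c / a) ≤ (∑ i, (hC.eigenvalues i - a)) / a := by
          rw [← neg_div]
          exact div_le_div_of_nonneg_right htr ha.le
        have h8 : (∑ i, (hC.eigenvalues i - a) ^ 2) / a ^ 2 ≤ (c / a) ^ 2 := by
          rw [div_pow]
          exact div_le_div_of_nonneg_right hsq (by positivity)
        -- The quadratic term costs (11/10)(c/a)² ≤ (1/10)(c/a), which yields the constant 11/10.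
        have h9 : c / a ≤ 1 / 11 := by
          rw [div_le_iff₀ ha]
          linarith
        have h10 : 0 ≤ c / a := by positivity
        have h11 : 11 / 10 * c / a = 11 / 10 * (c / a) := by ring
        rw [h11]
        nlinarith
    _ = ∏ i, (a * Real.exp ((hC.eigenvalues i - a) / a -
      11 / 10 * ((hC.eigenvalues i - a) ^ 2 / a ^ 2))) := by
        rw [Finset.prod_mul_distrib, ← Real.exp_sum]
        simp
    _ ≤ C.det := by
        rw [hdet]
        exact Finset.prod_le_prod (fun i _ => by positivity) fun i _ => hterm i

end Matrix

namespace EisCusp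

/-! ### Squarefree level carries a single Eisenstein newform -/

theorem EisensteinPair.level_eq_one {M : ℕ} (hM : Squarefree M) (P : EisensteinPair M) :
    P.u = 1 ∧ P.v = 1 := by
  have hsq : Squarefree (P.u * P.v) := hM.squarefree_of_dvd P.dvd
  have hco : P.u.Coprime P.v := Nat.coprime_of_squarefree_mul hsq
  have : NeZero (P.u * P.v) := ⟨hsq.ne_zero⟩
  -- At level uv the two characters are mutually inverse; neither inversion nor a change of level
  -- alters the conductor.
  have h := congrArg DirichletCharacter.conductor (eq_inv_of_mul_eq_one_left P.mul_eq_one)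
  rw [DirichletCharacter.conductor_inv, DirichletCharacter.conductor_changeLevel,
    DirichletCharacter.conductor_changeLevel, P.ψ_primitive, P.φ_primitive] at h
  have hu : P.u = 1 := by
    rw [← h] at hco
    exact (Nat.coprime_self _).1 hco
  exact ⟨hu, h ▸ hu⟩

theorem EisensteinPair.subsingleton {M : ℕ} (hM : Squarefree M) :
    Subsingleton (EisensteinPair M) := by
  refine ⟨fun P P' => ?_⟩
  obtain ⟨hu, hv⟩ := P.level_eq_one hM
  obtain ⟨hu', hv'⟩ := P'.level_eq_one hM
  obtain ⟨u, v, ψ, φ, h1, h2, h3, h4⟩ := P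
  obtain ⟨u', v', ψ', φ', h1', h2', h3', h4'⟩ := P'
  dsimp only at hu hv hu' hv'
  subst hu hv hu' hv'
  obtain rfl : ψ = ψ' := (DirichletCharacter.level_one ψ).trans
    (DirichletCharacter.level_one ψ').symm
  obtain rfl : φ = φ' := (DirichletCharacter.level_one φ).trans
    (DirichletCharacter.level_one φ').symm
  rfl

theorem EisensteinPair.nonempty (M : ℕ) : Nonempty (EisensteinPair M) :=
  ⟨{ u := 1, v := 1, ψ := 1, φ := 1
     ψ_primitive := DirichletCharacter.isPrimitive_one_level_one
     φ_primitive := DirichletCharacter.isPrimitive_one_level_one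
     dvd := by simp
     mul_eq_one := DirichletCharacter.level_one' _ (by norm_num) }⟩

theorem eq_one_of_equiv_eisensteinPair {M ε : ℕ} (hM : Squarefree M)
    (P : Fin ε ≃ EisensteinPair M) : ε = 1 := by
  have := EisensteinPair.subsingleton hM
  have : Unique (EisensteinPair M) := @Unique.mk' _ ⟨(EisensteinPair.nonempty M).some⟩ _
  simpa using Fintype.card_congr (P.trans (Equiv.ofUnique (EisensteinPair M) Unit))

theorem EisensteinPair.coeff_prime {M : ℕ} (hM : Squarefree M) (P : EisensteinPair M) (k : ℕ)
    {p : ℕ} (hp : p.Prime) : P.coeff k p = 1 + (p : ℂ) ^ (k - 1) := by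
  obtain ⟨hu, hv⟩ := P.level_eq_one hM
  obtain ⟨u, v, ψ, φ, h1, h2, h3, h4⟩ := P
  dsimp only at hu hv
  subst hu hv
  obtain rfl := DirichletCharacter.level_one ψ
  obtain rfl := DirichletCharacter.level_one φ
  have h : ∀ x : ZMod 1, (1 : DirichletCharacter ℂ 1) x = 1 := fun x => by
    rw [Subsingleton.elim x 1, map_one]
  simp only [EisensteinPair.coeff, h, one_mul]
  rw [Nat.sum_divisorsAntidiagonal (f := fun _ b => (b : ℂ) ^ (k - 1)), hp.sum_divisors]
  simp [Nat.div_self hp.pos]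

end EisCusp

/-! ### Bordered Gram determinants -/

namespace Matrix

theorem det_fromBlocks_unit_border {m n : Type*} [Unique m] [Fintype n] [DecidableEq n]
    [DecidableEq m] [Fintype m]
    (A : ℝ) (b : n → ℝ) {C : Matrix n n ℝ} (hC : C.det ≠ 0) :
    (fromBlocks (of fun _ _ : m => A) (of fun (_ : m) j => b j) (of fun i (_ : m) => b i) C).det =
      C.det * (A - b ⬝ᵥ C⁻¹ *ᵥ b) := by
  have := invertibleOfIsUnitDet C (isUnit_iff_ne_zero.2 hC)
  rw [det_fromBlocks₂₂, invOf_eq_nonsing_inv, det_unique (n := m)]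
  congr 1
  rw [sub_apply, Matrix.mul_assoc, mul_apply]
  simp [dotProduct, mul_apply, mulVec]

end Matrix

open Matrix in
/-- If `C` is the Gram matrix of the functions `a_i`, the Schur complement term `bᵀ C⁻¹ b` for
`b_i = ⟨v + w, a_i⟩` is controlled by `‖v‖²` (Bessel) and by the size of the `⟨w, a_i⟩`. -/
theorem gram_schur_term_le {n α : Type*} [Fintype n] (t : Finset α) (a : n → α → ℝ)
    (v w : α → ℝ) {G l : ℝ} (hl : 0 < l) (hG : ∀ i, |∑ p ∈ t, a i p * w p| ≤ G) (x : n → ℝ)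
    (hx : (of fun i j => ∑ p ∈ t, a i p * a j p) *ᵥ x = fun i => ∑ p ∈ t, (v p + w p) * a i p)
    (hlx : l * ∑ i, x i ^ 2 ≤ x ⬝ᵥ (of fun i j => ∑ p ∈ t, a i p * a j p) *ᵥ x) :
    0 ≤ (fun i => ∑ p ∈ t, (v p + w p) * a i p) ⬝ᵥ x ∧
    (fun i => ∑ p ∈ t, (v p + w p) * a i p) ⬝ᵥ x ≤
      4 * (∑ p ∈ t, v p ^ 2) + 4 / 3 * (Fintype.card n * G ^ 2 / l) := by
  set C : Matrix n n ℝ := of fun i j => ∑ p ∈ t, a i p * a j p with hC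
  set b : n → ℝ := fun i => ∑ p ∈ t, (v p + w p) * a i p with hb
  set q := b ⬝ᵥ x with hq
  -- y is the orthogonal projection of v + w onto the span of the a_i, and q = ‖y‖² = ⟨v, y⟩ + ⟨w,
  -- y⟩.
  set y : α → ℝ := fun p => ∑ i, a i p * x i with hy
  have hq1 : x ⬝ᵥ C *ᵥ x = q := by rw [hx, dotProduct_comm]
  have hq2 : q = ∑ p ∈ t, y p ^ 2 := by
    rw [← hq1]
    simp only [dotProduct, mulVec, hC, of_apply, hy, sq, Finset.mul_sum,
      Finset.sum_mul]
    rw [Finset.sum_congr rfl fun i _ => Finset.sum_comm]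
    rw [Finset.sum_comm]
    exact Finset.sum_congr rfl fun p _ => Finset.sum_congr rfl fun i _ =>
      Finset.sum_congr rfl fun j _ => by ring
  have hq3 : q = (∑ p ∈ t, v p * y p) + ∑ i, (∑ p ∈ t, a i p * w p) * x i := by
    simp only [hq, hb, dotProduct, hy, Finset.mul_sum, Finset.sum_mul]
    rw [Finset.sum_comm (s := t) (t := Finset.univ), ← Finset.sum_add_distrib]
    refine Finset.sum_congr rfl fun i _ => ?_
    rw [← Finset.sum_add_distrib]
    exact Finset.sum_congr rfl fun p _ => by ring
  have hq0 : 0 ≤ q := by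
    rw [hq2]
    positivity
  refine ⟨hq0, ?_⟩
  set V := ∑ p ∈ t, v p ^ 2
  set c := ∑ p ∈ t, v p * y p
  set g := ∑ i, (∑ p ∈ t, a i p * w p) * x i
  set B := Fintype.card n * G ^ 2 / l with hB
  have hV : 0 ≤ V := Finset.sum_nonneg fun p _ => sq_nonneg _
  have hB0 : 0 ≤ B := by positivity
  have hc : c ^ 2 ≤ V * q := by
    rw [hq2]
    exact Finset.sum_mul_sq_le_sq_mul_sq _ _ _
  have hg : g ^ 2 ≤ B * q := by
    have h1 : g ^ 2 ≤ (∑ i, (∑ p ∈ t, a i p * w p) ^ 2) * ∑ i, x i ^ 2 :=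
      Finset.sum_mul_sq_le_sq_mul_sq _ _ _
    have h2 : ∑ i, (∑ p ∈ t, a i p * w p) ^ 2 ≤ Fintype.card n * G ^ 2 := by
      rw [← nsmul_eq_mul]
      exact Finset.sum_le_card_nsmul _ _ _ fun i _ => sq_le_sq' (abs_le.1 (hG i)).1 (abs_le.1 (hG i)).2
    have h3 : ∑ i, x i ^ 2 ≤ q / l := by
      rw [le_div_iff₀ hl, mul_comm, ← hq1]
      exact hlx
    calc g ^ 2 ≤ _ := h1
      _ ≤ Fintype.card n * G ^ 2 * (q / l) := by gcongr
      _ = B * q := by rw [hB]; ring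
  -- (c + g)² ≤ 4c² + (4/3)g², the difference being (3c - g)²/3. The weights are uneven because V is
  -- at most T/8, while the term in G has little room.
  have hfin : q * q ≤ (4 * V + 4 / 3 * B) * q := by
    nlinarith [sq_nonneg (3 * c - g), congrArg (· ^ 2) hq3]
  rcases hq0.eq_or_lt with h0 | h0
  · rw [← h0]
    positivity
  · exact le_of_mul_le_mul_right hfin h0

/-! ### The error terms -/

/-- The value 1.38 lies just below log 4 = 2 log 2; it is the slack that absorbs the constants. -/
theorem le_log_add_three {x : ℝ} (hx : 1 ≤ x) :
    1.38 ≤ Real.log (x + 3) := by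
  have h1 : Real.log 4 ≤ Real.log (x + 3) := Real.log_le_log (by norm_num) (by linarith)
  have h2 : Real.log 4 = 2 * Real.log 2 := by
    rw [show (4 : ℝ) = 2 ^ 2 by norm_num, Real.log_pow]
    norm_num
  linarith [Real.log_two_gt_d9]

/-- The numerical estimate: `D` is the determinant of the cuspidal block, `A = V + 2T + W` the
Eisenstein entry and `q` the Schur complement term. -/
theorem abs_bordered_det_sub_le {s : ℕ} {T W V H F G R D q : ℝ} (hT : 0 < T) (hW : 0 ≤ W)
    (hV : 0 ≤ V) (hVT : 8 * V ≤ T) (hH : 0 ≤ H) (hF : 0 ≤ F) (hG : 0 ≤ G) (hR : 0 ≤ R)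
    (hsH : 11 * (s * H) ≤ T) (hD : D ≤ (T + H) ^ s)
    (hD' : T ^ s * (1 - 11 / 10 * (s * H) / T) ≤ D) (hq : 0 ≤ q)
    (hq' : q ≤ 4 * V + 4 / 3 * (s * G ^ 2 / (T - s * H))) :
    |D * (V + 2 * T + W - q) - T ^ s * W| ≤
      W * ((H + T) ^ s - T ^ s + s * Real.log (s + 3) * (H + T) ^ (s - 1) * H)
      + Real.log 4 * (V + 2 * T + F) *
        ((H + T) ^ s - T ^ s + s * Real.log (s + 3) * (H + T) ^ (s - 1) * H)
      + Real.log 4 * T ^ s * (V + 2 * T + F)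
      + Real.log 4 * (s * Real.log (s + 3)) * (H + T) ^ (s - 1) * (R + G) ^ 2 := by
  set Ls := Real.log (s + 3) with hLs
  set L := Real.log 4 with hLdef
  have hL : 1.38 ≤ L := by
    have := le_log_add_three le_rfl
    norm_num at this ⊢
    exact this
  set P := (H + T) ^ (s - 1) with hP
  have hP0 : 0 ≤ P := by positivity
  have hTs : 0 < T ^ s := by positivity
  have hsLs : (s : ℝ) * 1.38 ≤ s * Ls := by
    rcases Nat.eq_zero_or_pos s with h | h
    · simp [h]
    · exact mul_le_mul_of_nonneg_left (le_log_add_three (by exact_mod_cast h)) (by positivity)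
  have hs0 : (0 : ℝ) ≤ s := by positivity
  set Q := (H + T) ^ s - T ^ s + s * Ls * P * H with hQ
  have hpow : T ^ s ≤ (H + T) ^ s := pow_le_pow_left₀ hT.le (by linarith) s
  -- The factor s covers s = 0, where the truncated exponent s - 1 is 0 and P = 1.
  have hPT : (s : ℝ) * (T ^ s / T) ≤ s * P := by
    rcases Nat.eq_zero_or_pos s with h | h
    · simp [h]
    · refine mul_le_mul_of_nonneg_left ?_ hs0
      rw [div_le_iff₀ hT, hP]
      obtain ⟨r, rfl⟩ := Nat.exists_eq_add_of_lt h
      simp only [zero_add, Nat.add_sub_cancel, pow_succ]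
      exact mul_le_mul_of_nonneg_right (pow_le_pow_left₀ hT.le (by linarith) r) hT.le
  have hPs : (s : ℝ) * (T + H) ^ s = s * ((T + H) * P) := by
    rcases Nat.eq_zero_or_pos s with h | h
    · simp [h]
    · rw [hP, add_comm H T, mul_pow_sub_one h.ne']
  have hPH : (s : ℝ) * 1.38 * (P * H) ≤ s * Ls * (P * H) :=
    mul_le_mul_of_nonneg_right hsLs (by positivity)
  have hsPH : 0 ≤ (s : ℝ) * (P * H) := by positivity
  have hQ0 : 0 ≤ Q := by linarith
  have hDQ : D - T ^ s ≤ Q := by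
    rw [add_comm T H] at hD
    linarith
  have hDQ' : T ^ s - D ≤ Q := by
    have h1 : T ^ s * (1 - 11 / 10 * (s * H) / T) = T ^ s - 11 / 10 * (s * (T ^ s / T)) * H := by
      ring
    have h2 := mul_le_mul_of_nonneg_right hPT hH
    linarith
  have hD0 : 0 ≤ D := by
    refine le_trans (mul_nonneg hTs.le ?_) hD'
    rw [sub_nonneg, div_le_one hT]
    linarith
  have hl : 0 < T - s * H := by linarith
  have hX : 0 ≤ (s : ℝ) * (P * (R + G) ^ 2) := by positivity
  -- 1.9 < 1.38², from the two logarithms.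
  have hlast : 1.9 * (s * (P * (R + G) ^ 2)) ≤ L * (s * Ls) * P * (R + G) ^ 2 := by
    have h1 : 1.9 * (s : ℝ) ≤ L * (s * Ls) := by
      have := mul_le_mul hL hsLs (by positivity) (by linarith)
      linarith
    have h2 := mul_le_mul_of_nonneg_right h1 (show 0 ≤ P * (R + G) ^ 2 by positivity)
    linarith
  have hET : 0 ≤ L * T ^ s * (V + 2 * T + F) := by positivity
  have hEQ : (1.38 * (V + 2 * T)) * Q ≤ L * (V + 2 * T + F) * Q := by
    refine mul_le_mul_of_nonneg_right ?_ hQ0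
    exact mul_le_mul hL (by linarith) (by positivity) (by linarith)
  have hETs : 1.38 * T ^ s * (V + 2 * T) ≤ L * T ^ s * (V + 2 * T + F) :=
    mul_le_mul (mul_le_mul_of_nonneg_right hL hTs.le) (by linarith) (by positivity) (by positivity)
  rw [abs_le]
  constructor
  -- The lower bound closes because 2 + 1/2 ≤ 2 · 1.38 in the coefficient of Q·T and 1.6 ≤ 1.9 in
  -- the last term.
  · have hDq : D * q ≤ (T ^ s + Q) * (T / 2) + 1.6 * (s * (P * (R + G) ^ 2)) := by
      have h1 : D * q ≤ D * (4 * V) + D * (4 / 3 * (s * G ^ 2 / (T - s * H))) := by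
        rw [← mul_add]
        exact mul_le_mul_of_nonneg_left hq' hD0
      have h2 : D * (4 * V) ≤ (T ^ s + Q) * (T / 2) :=
        mul_le_mul (by linarith) (by linarith) (by positivity) (by linarith)
      have h3 : D * (4 / 3 * (s * G ^ 2 / (T - s * H))) ≤ 1.6 * (s * (P * (R + G) ^ 2)) := by
        -- For s ≥ 1 this is exactly 11sH ≤ T after H ≤ sH; then 1.6 = (4/3) · 1.2.
        have h4 : (s : ℝ) * (T + H) ≤ s * (1.2 * (T - s * H)) := by
          rcases Nat.eq_zero_or_pos s with h | h
          · simp [h]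
          · refine mul_le_mul_of_nonneg_left ?_ hs0
            have : 1 * H ≤ s * H := mul_le_mul_of_nonneg_right (by exact_mod_cast h) hH
            linarith
        have h5 : D * s ≤ 1.2 * (T - s * H) * (s * P) := by
          calc D * s ≤ (T + H) ^ s * s := mul_le_mul_of_nonneg_right hD hs0
            _ = s * (T + H) * P := by rw [mul_comm, hPs, mul_assoc]
            _ ≤ s * (1.2 * (T - s * H)) * P := mul_le_mul_of_nonneg_right h4 hP0
            _ = _ := by ring
        have h6 : D * s / (T - s * H) ≤ 1.2 * (s * P) := by
          rw [div_le_iff₀ hl]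
          linarith
        calc D * (4 / 3 * (s * G ^ 2 / (T - s * H)))
            = 4 / 3 * (D * s / (T - s * H)) * G ^ 2 := by ring
          _ ≤ 4 / 3 * (1.2 * (s * P)) * (R + G) ^ 2 := by
            refine mul_le_mul (by linarith) (pow_le_pow_left₀ hG (by linarith) 2) (by positivity)
              (by positivity)
          _ = _ := by ring
      linarith
    have hA : (T ^ s - D) * (V + 2 * T + W) ≤ Q * (V + 2 * T + W) :=
      mul_le_mul_of_nonneg_right hDQ' (by positivity)
    have h7 : 0 ≤ T ^ s * V := by positivity
    have h8 : 0 ≤ T ^ s * T := by positivity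
    have h9 : 0 ≤ Q * V := by positivity
    have h10 : 0 ≤ Q * T := by positivity
    linarith
  · have hA : (D - T ^ s) * (V + 2 * T + W) ≤ Q * (V + 2 * T + W) :=
      mul_le_mul_of_nonneg_right hDQ (by positivity)
    have h7 : 0 ≤ T ^ s * V := by positivity
    have h8 : 0 ≤ T ^ s * T := by positivity
    have h9 : 0 ≤ Q * V := by positivity
    have h10 : 0 ≤ Q * T := by positivity
    have h11 : 0 ≤ D * q := by positivity
    linarith

namespace EisCusp

/-! ### The determinant sum as a Gram determinant -/

/-- The normalised prime coefficients: `p^{(1-k)/2} + p^{(k-1)/2}` for the Eisenstein newform, and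
`â_p` for the cuspidal ones. -/
noncomputable def primeCoeff (k : ℕ) {s : ℕ} (f : Fin s → UpperHalfPlane → ℂ) (c : Fin 1 ⊕ Fin s) (p : ℕ) : ℝ :=
  Sum.elim (fun _ => (p : ℝ) ^ ((1 - (k : ℝ)) / 2) + (p : ℝ) ^ (((k : ℝ) - 1) / 2))
    (fun j => normCoeff k (f j) p) c

theorem prime_of_mem_primesUpTo {M p : ℕ} {X : ℝ} (hp : p ∈ primesUpTo M X) :
    p.Prime ∧ ¬ p ∣ M := by
  simpa using (Finset.mem_filter.1 hp).2

theorem inv_rpow_half {p : ℕ} (hp : 0 < p) (k : ℕ) :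
    (p : ℝ) ^ ((1 - (k : ℝ)) / 2) = ((p : ℝ) ^ (((k : ℝ) - 1) / 2))⁻¹ := by
  rw [← Real.rpow_neg (by positivity)]
  congr 1
  ring

theorem rpow_half_sq (p k : ℕ) :
    ((p : ℝ) ^ (((k : ℝ) - 1) / 2)) ^ 2 = (p : ℝ) ^ ((k : ℝ) - 1) := by
  rw [← Real.rpow_natCast, ← Real.rpow_mul (by positivity)]
  congr 1
  push_cast
  ring

theorem rpow_neg_half_sq (p k : ℕ) :
    ((p : ℝ) ^ ((1 - (k : ℝ)) / 2)) ^ 2 = (p : ℝ) ^ (1 - (k : ℝ)) := by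
  rw [← Real.rpow_natCast, ← Real.rpow_mul (by positivity)]
  congr 1
  push_cast
  ring

/-- Doubling the s cuspidal columns removes their halves and leaves a real matrix; squaring accounts
for the factor 4^s. -/
theorem two_pow_mul_det_matrixES {k M : ℕ} (hk : 1 ≤ k) (hM : Squarefree M) {s : ℕ}
    (P : Fin 1 → EisensteinPair M) (f : Fin s → UpperHalfPlane → ℂ) {p : Fin 1 ⊕ Fin s → ℕ}
    (hp : ∀ i, (p i).Prime) :
    2 ^ s * (matrixES k M P f p).det =
      ((Matrix.of fun i c => primeCoeff k f c (p i)).det : ℝ) := by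
  have h := Matrix.det_mul_row (Sum.elim (fun _ => 1) fun _ => 2 : Fin 1 ⊕ Fin s → ℂ)
    (matrixES k M P f p)
  rw [Fintype.prod_sum_type] at h
  simp only [Sum.elim_inl, Sum.elim_inr, Finset.prod_const, Finset.card_univ, Fintype.card_fin,
    one_pow, one_mul] at h
  rw [← h]
  have hmap := (RingHom.map_det Complex.ofRealHom
    (Matrix.of fun i c => primeCoeff k f c (p i)))
  rw [Complex.ofRealHom_eq_coe] at hmap
  rw [hmap]
  congr 1
  ext i c
  rcases c with j | j
  · have hpos := (hp i).pos
    have hw : ((p i : ℝ) ^ (((k : ℝ) - 1) / 2)) ≠ 0 := by positivity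
    have h2 : ((p i : ℝ) ^ (((k : ℝ) - 1) / 2)) ^ 2 = (p i : ℝ) ^ (k - 1) := by
      rw [rpow_half_sq, ← Real.rpow_natCast, Nat.cast_sub hk, Nat.cast_one]
    have hreal : (1 + (p i : ℝ) ^ (k - 1)) / (p i : ℝ) ^ (((k : ℝ) - 1) / 2) =
        (p i : ℝ) ^ ((1 - (k : ℝ)) / 2) + (p i : ℝ) ^ (((k : ℝ) - 1) / 2) := by
      rw [inv_rpow_half hpos, ← h2]
      field_simp
    simp only [Matrix.of_apply, matrixES, Sum.elim_inl, one_mul, RingHom.mapMatrix_apply,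
      Matrix.map_apply, primeCoeff, (P j).coeff_prime hM k (hp i), Complex.ofRealHom_eq_coe]
    rw [← hreal]
    push_cast
    rfl
  · simp only [Matrix.of_apply, matrixES, Sum.elim_inr, RingHom.mapMatrix_apply,
      Matrix.map_apply, primeCoeff, Complex.ofRealHom_eq_coe]
    push_cast
    ring

theorem four_pow_mul_detSum {k M : ℕ} (hk : 1 ≤ k) (hM : Squarefree M) {s : ℕ}
    (P : Fin 1 → EisensteinPair M) (f : Fin s → UpperHalfPlane → ℂ) (X : ℝ) :
    4 ^ s * ((1 + s).factorial : ℝ)⁻¹ * detSum k M P f X =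
      (Matrix.of fun c d => ∑ p ∈ primesUpTo M X, primeCoeff k f c p * primeCoeff k f d p).det := by
  have h := Matrix.sum_piFinset_det_sq (primeCoeff k f) (primesUpTo M X)
  simp only [Fintype.card_sum, Fintype.card_fin] at h
  have hfac : ((1 + s).factorial : ℝ) ≠ 0 := by positivity
  rw [mul_right_comm, ← div_eq_mul_inv, div_eq_iff hfac, mul_comm _ ((1 + s).factorial : ℝ), ← h,
    detSum, Finset.mul_sum]
  refine Finset.sum_congr rfl fun p hp => ?_
  have hp' : ∀ i, (p i).Prime := fun i =>
    (prime_of_mem_primesUpTo (Fintype.mem_piFinset.1 hp i)).1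
  have h2 := congrArg (fun z : ℂ => ‖z‖ ^ 2) (two_pow_mul_det_matrixES hk hM P f hp')
  simp only [norm_mul, norm_pow, Complex.norm_real, Real.norm_eq_abs, sq_abs, mul_pow] at h2
  rw [← h2, ← pow_mul, mul_comm s 2, pow_mul]
  norm_num

/-! ### Bounds for the entries -/

section

variable {k M s : ℕ} (f : Fin s → UpperHalfPlane → ℂ) (X : ℝ)

theorem piSum_zero_eq_card : piSum M 0 X = (primesUpTo M X).card := by simp [piSum]

theorem piSum_nonneg (l : ℝ) : 0 ≤ piSum M l X :=
  Finset.sum_nonneg fun p _ => Real.rpow_nonneg (Nat.cast_nonneg p) l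

theorem eight_mul_piSum_one_sub_le (hk : 4 ≤ k) :
    8 * piSum M (1 - (k : ℝ)) X ≤ piSum M 0 X := by
  rw [piSum, piSum, Finset.mul_sum]
  refine Finset.sum_le_sum fun p hp => ?_
  have h2 : (2 : ℝ) ≤ p := by exact_mod_cast (prime_of_mem_primesUpTo hp).1.two_le
  have hk' : (4 : ℝ) ≤ k := by exact_mod_cast hk
  have h1 : (p : ℝ) ^ (1 - (k : ℝ)) ≤ (p : ℝ) ^ (-3 : ℝ) :=
    Real.rpow_le_rpow_of_exponent_le (by linarith) (by linarith)
  have h3 : (p : ℝ) ^ (-3 : ℝ) ≤ (2 : ℝ) ^ (-3 : ℝ) :=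
    Real.rpow_le_rpow_of_nonpos (by norm_num) h2 (by norm_num)
  have h4 : (2 : ℝ) ^ (-3 : ℝ) = 1 / 8 := by
    rw [Real.rpow_neg (by norm_num)]
    norm_num
  have h5 := h1.trans (h3.trans_eq h4)
  rw [Real.rpow_zero]
  linarith

theorem sumF_nonneg : 0 ≤ sumF k M X := Real.iSup_nonneg fun _ => norm_nonneg _

theorem sumG_nonneg : 0 ≤ sumG k M f X := Real.iSup_nonneg fun _ => norm_nonneg _

theorem sumH_nonneg : 0 ≤ sumH k M f X :=
  le_max_of_le_left (Real.iSup_nonneg fun _ => abs_nonneg _)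

/-- The principal character modulo M takes part in the maximum and equals 1 at every prime of the
sum. -/
theorem abs_sum_le_sumG (hM : M ≠ 0) (j : Fin s) :
    |∑ p ∈ primesUpTo M X, normCoeff k (f j) p * (p : ℝ) ^ (((k : ℝ) - 1) / 2)| ≤
      sumG k M f X := by
  have : NeZero M := ⟨hM⟩
  have : Finite (DirichletCharacter ℂ M) := inferInstance
  refine le_trans (le_of_eq ?_) (le_ciSup (Set.finite_range _).bddAbove
    ((1 : DirichletCharacter ℂ M), j))
  rw [← Real.norm_eq_abs, ← Complex.norm_real]
  congr 1
  push_cast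
  refine Finset.sum_congr rfl fun p hp => ?_
  obtain ⟨hp, hpM⟩ := prime_of_mem_primesUpTo hp
  rw [MulChar.one_apply ((ZMod.isUnit_iff_coprime p M).2 ((hp.coprime_iff_not_dvd).2 hpM)),
    mul_one]

theorem abs_gram_sub_le_sumH (i j : Fin s) :
    |(Matrix.of fun i j => ∑ p ∈ primesUpTo M X, normCoeff k (f i) p * normCoeff k (f j) p) i j -
      piSum M 0 X * (1 : Matrix (Fin s) (Fin s) ℝ) i j| ≤ sumH k M f X := by
  rw [Matrix.of_apply]
  rcases eq_or_ne i j with rfl | hij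
  · refine le_max_of_le_left (le_trans (le_of_eq ?_) (le_ciSup (Set.finite_range _).bddAbove i))
    congr 1
    rw [Matrix.one_apply_eq, mul_one, piSum, ← Finset.sum_sub_distrib]
    refine Finset.sum_congr rfl fun p _ => ?_
    rw [chebyshevU2, Real.rpow_zero]
    ring
  · refine le_max_of_le_right (le_trans (le_of_eq ?_)
      (le_ciSup (Set.finite_range _).bddAbove ⟨(i, j), hij⟩))
    rw [Matrix.one_apply_ne hij, mul_zero, sub_zero]

theorem piSum_eq_zero_of_empty (h : primesUpTo M X = ∅) (l : ℝ) : piSum M l X = 0 := by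
  simp [piSum, h]

end

end EisCusp

/-! ### Assembly of the main estimate -/

theorem proposition2p1 (k M : ℕ) (hk : 4 ≤ k) (hk_even : Even k) (hM : Squarefree M)
    (ε s : ℕ) (P : Fin ε ≃ EisensteinPair M) (f : Fin s → UpperHalfPlane → ℂ)
    (hf : IsNewformBasis k M f) (X : ℝ)
    (hEF : sumE k M X + piSum M (k - 1) X ≥ 12 * ε * (sumE k M X + sumF k M X))
    (hH : sumH k M f X + piSum M 0 X ≥ 12 * s * sumH k M f X)
    (hEHG : (sumE k M X + piSum M (k - 1) X) * (sumH k M f X + piSum M 0 X) ≥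
      6 * ε * s * (piSum M ((1 - k) / 2) X + sumG k M f X) ^ 2) :
    |4 ^ s * ((ε + s).factorial : ℝ)⁻¹ * detSum k M P f X
        - piSum M 0 X ^ s * piSum M (k - 1) X ^ ε| ≤
      piSum M (k - 1) X ^ ε * sumQ k M f X
      + ε * Real.log (ε + 3) * (sumE k M X + piSum M (k - 1) X) ^ (ε - 1) *
          (sumE k M X + sumF k M X) * sumQ k M f X
      + ε * Real.log (ε + 3) * piSum M 0 X ^ s *
          (sumE k M X + piSum M (k - 1) X) ^ (ε - 1) * (sumE k M X + sumF k M X)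
      + ε * Real.log (ε + 3) * (s * Real.log (s + 3)) *
          (sumE k M X + piSum M (k - 1) X) ^ (ε - 1) *
          (sumH k M f X + piSum M 0 X) ^ (s - 1) *
          (piSum M ((1 - k) / 2) X + sumG k M f X) ^ 2 := by
  obtain rfl := eq_one_of_equiv_eisensteinPair hM P
  rw [four_pow_mul_detSum (by omega) hM]
  have hlog : Real.log ((1 : ℕ) + 3) = Real.log 4 := by norm_num
  rw [hlog]
  simp only [Nat.cast_one, one_mul, pow_one, Nat.sub_self, pow_zero, mul_one, sumQ, sumE]
  have hF := sumF_nonneg (k := k) (M := M) X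
  have hG := sumG_nonneg (k := k) (M := M) f X
  have hH0 := sumH_nonneg (k := k) (M := M) f X
  have hW := piSum_nonneg (M := M) X (k - 1)
  have hV := piSum_nonneg (M := M) X (1 - k)
  have hR := piSum_nonneg (M := M) X ((1 - k) / 2)
  have hT0 := piSum_nonneg (M := M) X 0
  -- With no primes, T = 0 and the estimates below fail to apply; the Gram matrix vanishes, and its
  -- Eisenstein row makes the determinant 0 even if s = 0.
  rcases (primesUpTo M X).eq_empty_or_nonempty with he | hne
  · have hdet : (Matrix.of fun c d => ∑ p ∈ primesUpTo M X,
        primeCoeff k f c p * primeCoeff k f d p).det = 0 :=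
      Matrix.det_eq_zero_of_row_eq_zero (Sum.inl 0) fun c => by simp [he]
    have hL : 0 ≤ Real.log 4 := Real.log_nonneg (by norm_num)
    have hLs : 0 ≤ Real.log ((s : ℝ) + 3) := Real.log_nonneg (by linarith [s.cast_nonneg (α := ℝ)])
    have hQ : 0 ≤ (sumH k M f X + piSum M 0 X) ^ s - piSum M 0 X ^ s := sub_nonneg.2
      (pow_le_pow_left₀ hT0 (by linarith) s)
    rw [hdet]
    simp only [piSum_eq_zero_of_empty X he (k - 1), mul_zero, sub_zero, abs_zero]
    positivity
  have hT : 0 < piSum M 0 X := by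
    rw [piSum_zero_eq_card]
    exact_mod_cast hne.card_pos
  -- For s ≥ 1, one of the twelve copies of sH pays for the H on the left of `hH`.
  have hsH : 11 * (s * sumH k M f X) ≤ piSum M 0 X := by
    rcases Nat.eq_zero_or_pos s with h | h
    · simp [h, hT0]
    · have : 1 * sumH k M f X ≤ s * sumH k M f X :=
        mul_le_mul_of_nonneg_right (by exact_mod_cast h) hH0
      linarith
  set C : Matrix (Fin s) (Fin s) ℝ :=
    Matrix.of fun i j => ∑ p ∈ primesUpTo M X, normCoeff k (f i) p * normCoeff k (f j) p with hC
  set b : Fin s → ℝ := fun i => ∑ p ∈ primesUpTo M X,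
    ((p : ℝ) ^ ((1 - (k : ℝ)) / 2) + (p : ℝ) ^ (((k : ℝ) - 1) / 2)) * normCoeff k (f i) p with hb
  have hCnear : ∀ i j, |C i j - piSum M 0 X * (1 : Matrix (Fin s) (Fin s) ℝ) i j| ≤
      sumH k M f X := abs_gram_sub_le_sumH f X
  have hCherm : C.IsHermitian := by
    ext i j
    simp [hC, mul_comm]
  have hDle := hCherm.det_le_of_entry_near hT hH0
    (by rw [Fintype.card_fin]; linarith [mul_nonneg (s.cast_nonneg (α := ℝ)) hH0]) hCnear
  have hleD := hCherm.le_det_of_entry_near hT hH0 (by rwa [Fintype.card_fin]) hCnear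
  rw [Fintype.card_fin] at hDle hleD
  have hDpos : 0 < C.det := by
    refine lt_of_lt_of_le (mul_pos (by positivity) ?_) hleD
    rw [sub_pos, div_lt_one hT]
    linarith
  have hl : 0 < piSum M 0 X - s * sumH k M f X := by linarith
  have hquad := Matrix.le_quadForm_of_entry_near hCnear (C⁻¹.mulVec b)
  rw [Fintype.card_fin] at hquad
  have hsolve : C.mulVec (C⁻¹.mulVec b) = b := by
    rw [Matrix.mulVec_mulVec, Matrix.mul_nonsing_inv _ (isUnit_iff_ne_zero.2 hDpos.ne'),
      Matrix.one_mulVec]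
  -- Bessel is affordable only for the decaying part p^{(1-k)/2}; the growing part has square norm
  -- W, so its inner products with the â_p are bounded by G instead.
  obtain ⟨hq, hq'⟩ := gram_schur_term_le (primesUpTo M X) (fun i => normCoeff k (f i))
    (fun p => (p : ℝ) ^ ((1 - (k : ℝ)) / 2)) (fun p => (p : ℝ) ^ (((k : ℝ) - 1) / 2)) hl
    (abs_sum_le_sumG f X hM.ne_zero) (C⁻¹.mulVec b) hsolve hquad
  have hV2 : ∑ p ∈ primesUpTo M X, ((p : ℝ) ^ ((1 - (k : ℝ)) / 2)) ^ 2 = piSum M (1 - k) X :=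
    Finset.sum_congr rfl fun p _ => rpow_neg_half_sq p k
  simp only [hV2, Fintype.card_fin] at hq'
  have hA : ∑ p ∈ primesUpTo M X, primeCoeff k f (Sum.inl 0) p * primeCoeff k f (Sum.inl 0) p =
      piSum M (1 - k) X + 2 * piSum M 0 X + piSum M (k - 1) X := by
    simp only [piSum, Finset.mul_sum, ← Finset.sum_add_distrib]
    refine Finset.sum_congr rfl fun p hp => ?_
    have hpos := (prime_of_mem_primesUpTo hp).1.pos
    rw [← rpow_neg_half_sq, ← rpow_half_sq, inv_rpow_half hpos, Real.rpow_zero, primeCoeff,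
      Sum.elim_inl, inv_rpow_half hpos]
    have hw : ((p : ℝ) ^ (((k : ℝ) - 1) / 2)) ≠ 0 := by positivity
    field_simp
    ring
  have hblock : (Matrix.of fun c d => ∑ p ∈ primesUpTo M X,
      primeCoeff k f c p * primeCoeff k f d p) =
      Matrix.fromBlocks
        (Matrix.of fun _ _ => piSum M (1 - k) X + 2 * piSum M 0 X + piSum M (k - 1) X)
        (Matrix.of fun _ j => b j) (Matrix.of fun i _ => b i) C := by
    ext c d
    rcases c with c | c <;> rcases d with d | d
    · obtain rfl := Subsingleton.elim c 0
      obtain rfl := Subsingleton.elim d 0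
      exact hA
    · rfl
    · change ∑ p ∈ primesUpTo M X, primeCoeff k f (Sum.inr c) p * primeCoeff k f (Sum.inl d) p =
        ∑ p ∈ primesUpTo M X, primeCoeff k f (Sum.inl d) p * primeCoeff k f (Sum.inr c) p
      exact Finset.sum_congr rfl fun p _ => mul_comm _ _
    · rfl
  rw [hblock, Matrix.det_fromBlocks_unit_border _ _ hDpos.ne']
  refine (abs_bordered_det_sub_le hT hW hV (eight_mul_piSum_one_sub_le X hk) hH0 hF hG hR hsH hDle
    hleD hq hq').trans (le_of_eq ?_)
  ring
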